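/- Let $n\ge 1$ and let $\mathcal A$ be a non-empty, possibly unbounded, set of real symmetric positive semi-definite $n\times n$ matrices. For a real symmetric $n\times n$ matrix $M$ put $$F(M)=\inf_{A\in\mathcal A}\operatorname{tr}(A^tMA)\in\mathbb R\cup\{-\infty\},\qquad \Gamma_{\mathcal A}=\{M \text{ symmetric}: F(M)>-\infty\},$$ and assume that the restriction of $F$ to $\Gamma_{\mathcal A}$ is continuous. Let $\Omega\subset\mathbb R^n$ be open and let $u\in C^2(\Omega)$ be $\mathcal A$-admissible, i.e. $D^2u(z)\in\Gamma_{\mathcal A}$ for every $z\in\Omega$. Let $\phi:(0,\infty)\to(0,\infty)$ satisfy $$\lim_{\varepsilon\to0^+}\phi(\varepsilon)=+\infty,\qquad \lim_{\varepsilon\to0^+}\varepsilon\,\phi(\varepsilon)=0 .$$ Then for every $x\in\Omega$ $$\inf_{\substack{A\in\mathcal A\\ A\le\phi(\varepsilon)I}}\ \frac{1}{|B_\varepsilon(0)|}\int_{B_\varepsilon(0)}u(x+Ay)\,dy-u(x)=\frac{\varepsilon^2}{2(n+2)}F(D^2u(x))+o(\varepsilon^2)\qquad\text{as }\varepsilon\to0^+,$$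 where $A\le\phi(\varepsilon)I$ means that $\phi(\varepsilon)I-A$ is positive semi-definite. Moreover, for all sufficiently small $\varepsilon>0$ the left-hand side is well defined and finite: the set of matrices over which the infimum is taken is non-empty, for each such $A$ one has $x+Ay\in\Omega$ for all $y\in B_\varepsilon(0)$ and $y\mapsto u(x+Ay)$ is integrable on $B_\varepsilon(0)$, and the averages are bounded below. -/

import Mathlib

open MeasureTheory Filter Topology Asymptotics
open scoped Matrix

noncomputable section

namespace MeanValue

/-- The operator `F(M) = inf_{A ∈ 𝒜} tr(Aᵗ M A)`, with the value `-∞` when the traces are not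
bounded below. -/
def F {n : ℕ} (𝒜 : Set (Matrix (Fin n) (Fin n) ℝ)) (M : Matrix (Fin n) (Fin n) ℝ) : EReal :=
  ⨅ A ∈ 𝒜, ((Matrix.trace (Aᵀ * M * A) : ℝ) : EReal)

/-- The cone `Γ_𝒜` of symmetric matrices `M` with `F(M) > -∞`. -/
def Gam {n : ℕ} (𝒜 : Set (Matrix (Fin n) (Fin n) ℝ)) : Set (Matrix (Fin n) (Fin n) ℝ) :=
  {M | M.IsSymm ∧ ⊥ < F 𝒜 M}

/-- The Hessian matrix `D²u(x)`, with entries the second partial derivatives of `u` at `x`. -/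
def hessian {n : ℕ} (u : EuclideanSpace ℝ (Fin n) → ℝ) (x : EuclideanSpace ℝ (Fin n)) :
    Matrix (Fin n) (Fin n) ℝ :=
  Matrix.of fun i j =>
    fderiv ℝ (fderiv ℝ u) x (EuclideanSpace.single i 1) (EuclideanSpace.single j 1)

/-- `u` is `C²` in (the open set) `Ω` and `D²u(x) ∈ Γ_𝒜` for every `x ∈ Ω`. -/
def IsAdmissible {n : ℕ} (𝒜 : Set (Matrix (Fin n) (Fin n) ℝ))
    (Ω : Set (EuclideanSpace ℝ (Fin n))) (u : EuclideanSpace ℝ (Fin n) → ℝ) : Prop :=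
  ContDiffOn ℝ 2 u Ω ∧ ∀ x ∈ Ω, hessian u x ∈ Gam 𝒜

/-- The matrices `A ∈ 𝒜` with `A ≤ r I`, i.e. such that `r I - A` is positive semi-definite. -/
def truncation {n : ℕ} (𝒜 : Set (Matrix (Fin n) (Fin n) ℝ)) (r : ℝ) :
    Set (Matrix (Fin n) (Fin n) ℝ) :=
  {A | A ∈ 𝒜 ∧ (r • (1 : Matrix (Fin n) (Fin n) ℝ) - A).PosSemidef}

/-- The average of `y ↦ u(x + A y)` over the ball `B_ε(0)`. -/
def ballMean {n : ℕ} (u : EuclideanSpace ℝ (Fin n) → ℝ) (x : EuclideanSpace ℝ (Fin n))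
    (ε : ℝ) (A : Matrix (Fin n) (Fin n) ℝ) : ℝ :=
  ⨍ y in Metric.ball (0 : EuclideanSpace ℝ (Fin n)) ε,
    u (x + Matrix.toEuclideanCLM (n := Fin n) (𝕜 := ℝ) A y)

end MeanValue

end

/-!
The Laplacian of `y ↦ u (x + A y)` is `tr (Aᵗ D²u A)`, evaluated at `x + A y`. Green's identity
against the paraboloid `(1 - ‖y‖²) / 2` writes the derivative in `t` of the mean of `v` over
`B_t(x)` as a weighted integral of `Δv`, so a bound `c ≤ Δv` or `Δv ≤ c` on `B_ε(x)` bounds the mean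
minus `v x` by `ε² c / (2 (n + 2))` from the same side. If `0 ≤ A ≤ φ(ε) I` then `‖A‖ ≤ φ(ε)`, and
since `ε φ(ε) → 0` all the points `x + A y` with `‖y‖ ≤ ε` lie in a fixed small neighbourhood of
`x`. There continuity of `F` on `Γ` bounds all the traces below by nearly `F(D²u(x))`, uniformly in
`A`, while a single nearly optimal `A`, admissible for small `ε` because `φ(ε) → ∞`, gives the
matching upper bound.
-/

namespace MeanValue

open InnerProductSpace Laplacian Metric Module Set

section ParaboloidCap

variable {E : Type*} [NormedAddCommGroup E]

/-- The function `(1 - ‖y‖²)⁺ / 2`. It vanishes outside the unit ball and has gradient `-y` inside,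
so integrating by parts against it turns radial derivatives over the ball into Laplacians. -/
noncomputable def paraboloidCap (y : E) : ℝ := (1 - min ‖y‖ 1 ^ 2) / 2

lemma paraboloidCap_of_norm_le_one {y : E} (hy : ‖y‖ ≤ 1) :
    paraboloidCap y = (1 - ‖y‖ ^ 2) / 2 := by
  rw [paraboloidCap, min_eq_left hy]

lemma paraboloidCap_of_one_le_norm {y : E} (hy : 1 ≤ ‖y‖) : paraboloidCap y = 0 := by
  rw [paraboloidCap, min_eq_right hy]
  norm_num

lemma support_paraboloidCap_subset : Function.support (paraboloidCap : E → ℝ) ⊆ ball 0 1 :=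
  fun _ hy => mem_ball_zero_iff.2 <| not_le.1 <| mt paraboloidCap_of_one_le_norm hy

lemma paraboloidCap_nonneg (y : E) : 0 ≤ paraboloidCap y := by
  have : min ‖y‖ 1 ^ 2 ≤ 1 := pow_le_one₀ (by positivity) (min_le_right _ _)
  unfold paraboloidCap
  linarith

lemma lipschitzWith_paraboloidCap : LipschitzWith 1 (paraboloidCap : E → ℝ) := by
  refine LipschitzWith.of_dist_le_mul fun y z => ?_
  have hmin : |min ‖y‖ 1 - min ‖z‖ 1| ≤ ‖y - z‖ :=
    calc |min ‖y‖ 1 - min ‖z‖ 1| ≤ max |‖y‖ - ‖z‖| |(1 : ℝ) - 1| := abs_min_sub_min_le_max ..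
      _ ≤ ‖y - z‖ := by simpa using abs_norm_sub_norm_le y z
  have hmean : (min ‖y‖ 1 + min ‖z‖ 1) / 2 ≤ 1 := by
    linarith [min_le_right ‖y‖ 1, min_le_right ‖z‖ 1]
  have hfactor : paraboloidCap y - paraboloidCap z =
      -((min ‖y‖ 1 + min ‖z‖ 1) / 2 * (min ‖y‖ 1 - min ‖z‖ 1)) := by
    unfold paraboloidCap
    ring
  rw [Real.dist_eq, dist_eq_norm, NNReal.coe_one, one_mul, hfactor, abs_neg, abs_mul,
    abs_of_nonneg (by positivity)]
  exact (mul_le_of_le_one_left (abs_nonneg _) hmean).trans hmin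

lemma hasCompactSupport_paraboloidCap [ProperSpace E] :
    HasCompactSupport (paraboloidCap : E → ℝ) :=
  .of_support_subset_isCompact (isCompact_closedBall 0 1)
    (support_paraboloidCap_subset.trans ball_subset_closedBall)

lemma lineDeriv_paraboloidCap_of_norm_lt_one {E : Type*} [NormedAddCommGroup E]
    [InnerProductSpace ℝ E] {y : E} (hy : ‖y‖ < 1) (e : E) :
    lineDeriv ℝ paraboloidCap y e = -inner ℝ y e := by
  have hsq : HasFDerivAt (fun z : E => (1 / 2 : ℝ) * (1 - ‖z‖ ^ 2))
      ((1 / 2 : ℝ) • -((2 : ℕ) • (innerSL ℝ y : E →L[ℝ] ℝ))) y :=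
    ((hasStrictFDerivAt_norm_sq y).hasFDerivAt.const_sub 1).const_mul _
  have heq : paraboloidCap =ᶠ[𝓝 y] fun z : E => (1 / 2 : ℝ) * (1 - ‖z‖ ^ 2) := by
    filter_upwards [continuous_norm.continuousAt.eventually_lt continuousAt_const hy] with z hz
    rw [paraboloidCap_of_norm_le_one hz.le]
    ring
  rw [((hsq.congr_of_eventuallyEq heq).hasLineDerivAt e).lineDeriv]
  simp

lemma lineDeriv_paraboloidCap_of_one_lt_norm [NormedSpace ℝ E] {y : E} (hy : 1 < ‖y‖) (e : E) :
    lineDeriv ℝ paraboloidCap y e = 0 := by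
  have heq : paraboloidCap =ᶠ[𝓝 y] fun _ : E => (0 : ℝ) := by
    filter_upwards [continuousAt_const.eventually_lt continuous_norm.continuousAt hy] with z hz
    exact paraboloidCap_of_one_le_norm hz.le
  rw [heq.lineDeriv_eq]
  simp [lineDeriv]

end ParaboloidCap

section SecondDerivative

variable {E G H : Type*} [NormedAddCommGroup E] [NormedSpace ℝ E] [NormedAddCommGroup G]
  [NormedSpace ℝ G] [NormedAddCommGroup H] [NormedSpace ℝ H]

lemma continuous_fderiv_fderiv {v : E → G} (hv : ContDiff ℝ 2 v) :
    Continuous (fderiv ℝ (fderiv ℝ v)) :=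
  (hv.fderiv_right (m := 1) (by norm_num)).continuous_fderiv (by norm_num)

lemma fderiv_fderiv_comp_add_clm {u : G → H} {x : G} {L : E →L[ℝ] G} {y : E}
    (hu : ContDiffAt ℝ 2 u (x + L y)) (e e' : E) :
    fderiv ℝ (fderiv ℝ fun z => u (x + L z)) y e e' =
      fderiv ℝ (fderiv ℝ u) (x + L y) (L e) (L e') := by
  have hL (z : E) : HasFDerivAt (fun z => x + L z) L z := L.hasFDerivAt.const_add x
  have hfirst : fderiv ℝ (fun z => u (x + L z)) =ᶠ[𝓝 y] fun z => (fderiv ℝ u (x + L z)).comp L := by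
    filter_upwards [(hL y).continuousAt.eventually (hu.eventually (by norm_num))] with z hz
    exact ((hz.differentiableAt (by norm_num)).hasFDerivAt.comp z (hL z)).fderiv
  have hsecond : HasFDerivAt (fderiv ℝ u) (fderiv ℝ (fderiv ℝ u) (x + L y)) (x + L y) :=
    ((hu.fderiv_right (m := 1) (by norm_num)).differentiableAt (by norm_num)).hasFDerivAt
  have hcomp := (hsecond.comp y (hL y)).clm_comp (hasFDerivAt_const L y)
  rw [hfirst.fderiv_eq]
  exact (DFunLike.congr_fun (DFunLike.congr_fun hcomp.fderiv e) e').trans (by simp)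

end SecondDerivative

section Laplacian

variable {E G : Type*} [NormedAddCommGroup E] [InnerProductSpace ℝ E] [FiniteDimensional ℝ E]
  [NormedAddCommGroup G] [NormedSpace ℝ G]

lemma laplacian_eq_sum_fderiv_fderiv {ι : Type*} [Fintype ι] (b : OrthonormalBasis ι ℝ E)
    (v : E → G) (y : E) : Δ v y = ∑ i, fderiv ℝ (fderiv ℝ v) y (b i) (b i) := by
  simp [laplacian_eq_iteratedFDeriv_orthonormalBasis v b, iteratedFDeriv_two_apply]

lemma continuous_laplacian {v : E → G} (hv : ContDiff ℝ 2 v) : Continuous (Δ v) := by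
  have := continuous_fderiv_fderiv hv
  rw [show Δ v = fun y => _ from
    funext (laplacian_eq_sum_fderiv_fderiv (stdOrthonormalBasis ℝ E) v)]
  fun_prop

lemma laplacian_norm_sq (y : E) : Δ (fun z : E => ‖z‖ ^ 2) y = 2 * finrank ℝ E := by
  have h (e : E) : fderiv ℝ (fderiv ℝ fun z : E => ‖z‖ ^ 2) y e e = 2 * ‖e‖ ^ 2 := by
    have hinner : HasFDerivAt (⇑(innerSL ℝ (E := E))) (innerSL ℝ : E →L[ℝ] E →L[ℝ] ℝ) y :=
      (innerSL ℝ : E →L[ℝ] E →L[ℝ] ℝ).hasFDerivAt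
    rw [fderiv_norm_sq, (hinner.const_smul 2).fderiv]
    rw [← real_inner_self_eq_norm_sq, two_mul]
    exact two_nsmul _
  rw [laplacian_eq_sum_fderiv_fderiv (stdOrthonormalBasis ℝ E)]
  simp [h, mul_comm]

lemma laplacian_comp_add_smul {v : E → G} {x y : E} {t : ℝ} (hv : ContDiffAt ℝ 2 v (x + t • y)) :
    Δ (fun z => v (x + t • z)) y = t ^ 2 • Δ v (x + t • y) := by
  let L : E →L[ℝ] E := t • .id ℝ E
  have h (e : E) : fderiv ℝ (fderiv ℝ fun z => v (x + t • z)) y e e =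
      t ^ 2 • fderiv ℝ (fderiv ℝ v) (x + t • y) e e := by
    simpa [L, smul_smul, sq] using fderiv_fderiv_comp_add_clm (L := L) hv e e
  simp only [laplacian_eq_sum_fderiv_fderiv (stdOrthonormalBasis ℝ E), h, Finset.smul_sum]

end Laplacian

section GreenIdentity

variable {E : Type*} [NormedAddCommGroup E] [InnerProductSpace ℝ E] [FiniteDimensional ℝ E]
  [MeasurableSpace E] [BorelSpace E] (μ : Measure E) [μ.IsAddHaarMeasure]

lemma integral_fderiv_fderiv_mul_paraboloidCap {v : E → ℝ} (hv : ContDiff ℝ 2 v) {C : NNReal}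
    (hC : LipschitzWith C (fderiv ℝ v)) (e : E) :
    ∫ y, fderiv ℝ (fderiv ℝ v) y e e * paraboloidCap y ∂μ =
      ∫ y in ball 0 1, inner ℝ y e * fderiv ℝ v y e ∂μ := by
  have hlip : LipschitzWith (‖ContinuousLinearMap.apply ℝ ℝ e‖₊ * C) fun y => fderiv ℝ v y e :=
    (ContinuousLinearMap.apply ℝ ℝ e).lipschitz.comp hC
  have hderiv (y : E) :
      lineDeriv ℝ (fun y => fderiv ℝ v y e) y e = fderiv ℝ (fderiv ℝ v) y e e := by
    have hy : HasFDerivAt (fderiv ℝ v) (fderiv ℝ (fderiv ℝ v) y) y :=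
      ((hv.fderiv_right (m := 1) (by norm_num)).differentiable (by norm_num) y).hasFDerivAt
    simpa using ((hy.clm_apply (hasFDerivAt_const e y)).hasLineDerivAt e).lineDeriv
  simp_rw [← hderiv]
  rw [hlip.integral_lineDeriv_mul_eq lipschitzWith_paraboloidCap hasCompactSupport_paraboloidCap e,
    ← integral_indicator measurableSet_ball]
  refine integral_congr_ae ?_
  have hsphere : ∀ᵐ y ∂μ, y ∉ sphere (0 : E) 1 :=
    measure_eq_zero_iff_ae_notMem.1 (Measure.addHaar_sphere_of_ne_zero μ 0 one_ne_zero)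
  filter_upwards [hsphere] with y hy
  rcases lt_or_gt_of_ne (mt mem_sphere_zero_iff_norm.2 hy) with hlt | hgt
  · rw [lineDeriv_paraboloidCap_of_norm_lt_one hlt,
      indicator_of_mem (mem_ball_zero_iff.2 hlt), inner_neg_right, neg_neg]
  · rw [lineDeriv_paraboloidCap_of_one_lt_norm hgt,
      indicator_of_notMem (mt mem_ball_zero_iff.1 hgt.not_gt), zero_mul]

lemma integral_laplacian_mul_paraboloidCap {v : E → ℝ} (hv : ContDiff ℝ 2 v) {C : NNReal}
    (hC : LipschitzWith C (fderiv ℝ v)) :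
    ∫ y, Δ v y * paraboloidCap y ∂μ = ∫ y in ball 0 1, fderiv ℝ v y y ∂μ := by
  let b := stdOrthonormalBasis ℝ E
  have hcont₁ := hv.continuous_fderiv (by norm_num)
  have := continuous_fderiv_fderiv hv
  have hcap := (lipschitzWith_paraboloidCap (E := E)).continuous
  have hint₂ (i) : Integrable (fun y => fderiv ℝ (fderiv ℝ v) y (b i) (b i) * paraboloidCap y) μ :=
    Continuous.integrable_of_hasCompactSupport (by fun_prop)
      hasCompactSupport_paraboloidCap.mul_left
  have hint₁ (i) : IntegrableOn (fun y => inner ℝ y (b i) * fderiv ℝ v y (b i)) (ball 0 1) μ := by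
    refine (Continuous.continuousOn ?_).integrableOn_compact (isCompact_closedBall 0 1)
      |>.mono_set ball_subset_closedBall
    fun_prop
  calc ∫ y, Δ v y * paraboloidCap y ∂μ
      = ∑ i, ∫ y, fderiv ℝ (fderiv ℝ v) y (b i) (b i) * paraboloidCap y ∂μ := by
        simp_rw [laplacian_eq_sum_fderiv_fderiv b, Finset.sum_mul]
        exact integral_finsetSum _ fun i _ => hint₂ i
    _ = ∑ i, ∫ y in ball 0 1, inner ℝ y (b i) * fderiv ℝ v y (b i) ∂μ :=
        Finset.sum_congr rfl fun i _ => integral_fderiv_fderiv_mul_paraboloidCap μ hv hC (b i)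
    _ = ∫ y in ball 0 1, ∑ i, inner ℝ y (b i) * fderiv ℝ v y (b i) ∂μ :=
        (integral_finsetSum _ fun i _ => hint₁ i).symm
    _ = ∫ y in ball 0 1, fderiv ℝ v y y ∂μ := by
        congr! with y
        generalize fderiv ℝ v y = T
        conv_rhs => rw [← b.sum_repr' y, map_sum]
        simp [real_inner_comm]

lemma integral_paraboloidCap :
    ∫ y, paraboloidCap y ∂μ = μ.real (ball 0 1) / (finrank ℝ E + 2) := by
  -- Green's identity for `‖y‖ ^ 2` is a linear equation for the integral, with no need for polar
  -- coordinates.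
  have hsq : ∫ y, 2 * finrank ℝ E * paraboloidCap y ∂μ = ∫ y in ball 0 1, 2 * ‖y‖ ^ 2 ∂μ := by
    have hlip : LipschitzWith ‖2 • innerSL ℝ (E := E)‖₊ (fderiv ℝ fun y : E => ‖y‖ ^ 2) := by
      rw [fderiv_norm_sq]
      exact (2 • innerSL ℝ (E := E)).lipschitz
    have := integral_laplacian_mul_paraboloidCap μ (contDiff_norm_sq ℝ) hlip
    simpa [laplacian_norm_sq, fderiv_norm_sq] using this
  have hcap : ∫ y, paraboloidCap y ∂μ = ∫ y in ball 0 1, (1 - ‖y‖ ^ 2) / 2 ∂μ := by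
    rw [← setIntegral_eq_integral_of_forall_compl_eq_zero fun y hy =>
      paraboloidCap_of_one_le_norm (not_lt.1 (mt mem_ball_zero_iff.2 hy))]
    exact setIntegral_congr_fun measurableSet_ball fun y hy =>
      paraboloidCap_of_norm_le_one (mem_ball_zero_iff.1 hy).le
  have hint : IntegrableOn (fun y : E => ‖y‖ ^ 2) (ball 0 1) μ :=
    ((continuous_norm.pow 2).continuousOn.integrableOn_compact (isCompact_closedBall 0 1)).mono_set
      ball_subset_closedBall
  have hone : IntegrableOn (fun _ : E => (1 : ℝ)) (ball 0 1) μ :=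
    integrableOn_const measure_ball_lt_top.ne
  rw [integral_const_mul, integral_const_mul] at hsq
  rw [integral_div, integral_sub hone hint, setIntegral_const, smul_eq_mul, mul_one] at hcap
  rw [eq_div_iff (by positivity)]
  linarith

end GreenIdentity

section Cutoff

variable {E G : Type*} [NormedAddCommGroup E] [InnerProductSpace ℝ E] [FiniteDimensional ℝ E]
  [NormedAddCommGroup G] [NormedSpace ℝ G]

lemma exists_contDiff_hasCompactSupport_eqOn_closedBall {n : ℕ} {v : E → G} {x : E}
    {r : ℝ} (hr : 0 < r) (hv : ∀ y ∈ closedBall x r, ContDiffAt ℝ n v y) :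
    ∃ w : E → G, ContDiff ℝ n w ∧ HasCompactSupport w ∧ EqOn w v (closedBall x r) := by
  have hopen : IsOpen {y | ContDiffAt ℝ n v y} :=
    isOpen_iff_mem_nhds.2 fun y (hy : ContDiffAt ℝ n v y) => hy.eventually (by simp)
  obtain ⟨δ, hδ, hsub⟩ := (isCompact_closedBall x r).exists_cthickening_subset_open hopen hv
  rw [cthickening_closedBall hδ.le hr.le, add_comm] at hsub
  let f : ContDiffBump x := ⟨r, r + δ, hr, lt_add_of_pos_right r hδ⟩
  refine ⟨fun y => f y • v y, contDiff_iff_contDiffAt.2 fun y => ?_, f.hasCompactSupport.smul_right,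
    fun y hy => by simp [f.one_of_mem_closedBall hy]⟩
  by_cases hy : y ∈ closedBall x (r + δ)
  · exact f.contDiffAt.smul (hsub hy)
  · have hzero : (fun y => f y • v y) =ᶠ[𝓝 y] fun _ => 0 := by
      filter_upwards [isClosed_closedBall.isOpen_compl.mem_nhds hy] with z hz
      simp [f.zero_of_le_dist (not_le.1 (mt mem_closedBall.2 hz)).le]
    exact contDiffAt_const.congr_of_eventuallyEq hzero

end Cutoff

section MeanValueInequality

variable {E : Type*} [NormedAddCommGroup E] [InnerProductSpace ℝ E] [FiniteDimensional ℝ E]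
  [MeasurableSpace E] [BorelSpace E] (μ : Measure E) [μ.IsAddHaarMeasure]

lemma setIntegral_fderiv_comp_smul {v : E → ℝ} (hv : ContDiff ℝ 2 v) (hc : HasCompactSupport v)
    {t : ℝ} (ht : t ≠ 0) :
    ∫ y in ball 0 1, fderiv ℝ v (t • y) y ∂μ = t * ∫ y, Δ v (t • y) * paraboloidCap y ∂μ := by
  let w : E → ℝ := fun y => v (t • y)
  have hw : ContDiff ℝ 2 w := hv.comp (contDiff_const_smul t)
  have hfderiv (y : E) : fderiv ℝ w y = t • fderiv ℝ v (t • y) := fderiv_comp_smul t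
  have hlaplacian (y : E) : Δ w y = t ^ 2 * Δ v (t • y) := by
    simpa [w] using laplacian_comp_add_smul (x := 0) (y := y) (t := t) hv.contDiffAt
  obtain ⟨C, hC⟩ := ContDiff.lipschitzWith_of_hasCompactSupport ((hc.comp_smul ht).fderiv ℝ)
    (hw.fderiv_right (m := 1) (by norm_num)) (by norm_num)
  have hgreen := integral_laplacian_mul_paraboloidCap μ hw hC
  simp only [hfderiv, hlaplacian, mul_assoc, integral_const_mul, smul_apply, smul_eq_mul] at hgreen
  exact mul_left_cancel₀ ht (by rw [← hgreen]; ring)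

lemma hasDerivAt_setIntegral_comp_smul {v : E → ℝ} (hv : ContDiff ℝ 1 v)
    (hc : HasCompactSupport v) (t : ℝ) :
    HasDerivAt (fun t : ℝ => ∫ y in ball 0 1, v (t • y) ∂μ)
      (∫ y in ball 0 1, fderiv ℝ v (t • y) y ∂μ) t := by
  have hcont := hv.continuous
  have hcont' : Continuous (fderiv ℝ v) := hv.continuous_fderiv (by norm_num)
  obtain ⟨C, hC⟩ := (hc.fderiv ℝ).exists_bound_of_continuous hcont'
  have hint {f : E → ℝ} (hf : Continuous f) : IntegrableOn f (ball 0 1) μ :=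
    (hf.continuousOn.integrableOn_compact (isCompact_closedBall 0 1)).mono_set
      ball_subset_closedBall
  refine (hasDerivAt_integral_of_dominated_loc_of_deriv_le (s := univ)
    (F := fun t y => v (t • y)) (F' := fun t y => fderiv ℝ v (t • y) y)
    (bound := fun y => C * ‖y‖) univ_mem ?_ (hint (by fun_prop)) ?_ ?_ (hint (by fun_prop)) ?_).2
  · exact .of_forall fun t => Continuous.aestronglyMeasurable (by fun_prop)
  · exact Continuous.aestronglyMeasurable (by fun_prop)
  · exact .of_forall fun y s _ => ContinuousLinearMap.le_of_opNorm_le _ (hC _) y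
  · refine .of_forall fun y s _ => ?_
    have hsmul : HasDerivAt (fun s : ℝ => s • y) y s := by
      simpa using (hasDerivAt_id s).smul_const y
    exact (hv.differentiable (by norm_num) _).hasFDerivAt.comp_hasDerivAt s hsmul

lemma le_setIntegral_fderiv_comp_smul_of_le_laplacian {v : E → ℝ} (hv : ContDiff ℝ 2 v)
    (hc : HasCompactSupport v) {c : ℝ} (h : ∀ y ∈ ball 0 1, c ≤ Δ v y) {t : ℝ} (ht : t ∈ Ioo 0 1) :
    t * (c * (μ.real (ball 0 1) / (finrank ℝ E + 2))) ≤
      ∫ y in ball 0 1, fderiv ℝ v (t • y) y ∂μ := by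
  have hcap := (lipschitzWith_paraboloidCap (E := E)).continuous
  have hlaplacian := continuous_laplacian hv
  rw [setIntegral_fderiv_comp_smul μ hv hc ht.1.ne', ← integral_paraboloidCap μ,
    ← integral_const_mul]
  refine mul_le_mul_of_nonneg_left (integral_mono ?_ ?_ fun y => ?_) ht.1.le
  · exact (hcap.integrable_of_hasCompactSupport hasCompactSupport_paraboloidCap).const_mul c
  · exact Continuous.integrable_of_hasCompactSupport (by fun_prop)
      hasCompactSupport_paraboloidCap.mul_left
  · rcases lt_or_ge ‖y‖ 1 with hy | hy
    · refine mul_le_mul_of_nonneg_right (h _ ?_) (paraboloidCap_nonneg y)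
      rw [mem_ball_zero_iff, norm_smul, Real.norm_of_nonneg ht.1.le]
      exact mul_lt_one_of_nonneg_of_lt_one_left ht.1.le ht.2 hy.le
    · simp [paraboloidCap_of_one_le_norm hy]

lemma half_le_sub_of_mul_le_deriv {g g' : ℝ → ℝ} {a : ℝ} (hg : ∀ t, HasDerivAt g (g' t) t)
    (h : ∀ t ∈ Ioo 0 1, t * a ≤ g' t) : a / 2 ≤ g 1 - g 0 := by
  have hderiv (t : ℝ) : HasDerivAt (fun t => g t - t ^ 2 * (a / 2)) (g' t - t * a) t :=
    ((hg t).sub ((hasDerivAt_pow 2 t).mul_const (a / 2))).congr_deriv (by norm_num; ring)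
  have hmono : MonotoneOn (fun t => g t - t ^ 2 * (a / 2)) (Icc 0 1) := by
    refine monotoneOn_of_deriv_nonneg (convex_Icc 0 1)
      (fun t _ => (hderiv t).continuousAt.continuousWithinAt)
      (fun t _ => (hderiv t).differentiableAt.differentiableWithinAt) fun t ht => ?_
    rw [interior_Icc] at ht
    rw [(hderiv t).deriv]
    exact sub_nonneg.2 (h t ht)
  have := hmono (left_mem_Icc.2 zero_le_one) (right_mem_Icc.2 zero_le_one) zero_le_one
  norm_num at this
  linarith

lemma le_setAverage_unitBall_sub_of_le_laplacian {v : E → ℝ} (hv : ContDiff ℝ 2 v)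
    (hc : HasCompactSupport v) {c : ℝ} (h : ∀ y ∈ ball 0 1, c ≤ Δ v y) :
    c / (2 * (finrank ℝ E + 2)) ≤ (⨍ y in ball 0 1, v y ∂μ) - v 0 := by
  have hpos : 0 < μ.real (ball (0 : E) 1) :=
    ENNReal.toReal_pos (measure_ball_pos μ _ one_pos).ne' measure_ball_lt_top.ne
  have key := half_le_sub_of_mul_le_deriv
    (hasDerivAt_setIntegral_comp_smul μ (hv.of_le (by norm_num)) hc)
    fun t ht => le_setIntegral_fderiv_comp_smul_of_le_laplacian μ hv hc h ht
  simp only [one_smul, zero_smul, setIntegral_const, smul_eq_mul] at key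
  rw [setAverage_eq, smul_eq_mul]
  refine le_of_mul_le_mul_left ?_ hpos
  calc μ.real (ball 0 1) * (c / (2 * (finrank ℝ E + 2)))
      = c * (μ.real (ball 0 1) / (finrank ℝ E + 2)) / 2 := by field_simp
    _ ≤ _ := key
    _ = _ := by rw [mul_sub, mul_inv_cancel_left₀ hpos.ne']

lemma setAverage_ball_eq_setAverage_unitBall {G : Type*} [NormedAddCommGroup G] [NormedSpace ℝ G]
    (v : E → G) (x : E) {r : ℝ} (hr : 0 < r) :
    ⨍ y in ball x r, v y ∂μ = ⨍ y in ball 0 1, v (x + r • y) ∂μ := by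
  have htranslate : ∫ y in ball x r, v y ∂μ = ∫ y in ball 0 r, v (x + y) ∂μ := by
    rw [← (measurePreserving_add_left μ x).setIntegral_preimage_emb
      (measurableEmbedding_addLeft x), preimage_add_left_ball]
    simp
  have hscale := Measure.setIntegral_comp_smul_of_pos μ (fun y => v (x + y)) (ball 0 1) hr
  rw [smul_unitBall_of_pos hr] at hscale
  rw [setAverage_eq, setAverage_eq, hscale, htranslate, measureReal_def,
    Measure.addHaar_ball_of_pos μ x hr, ENNReal.toReal_mul, ENNReal.toReal_ofReal (by positivity),
    mul_inv, mul_comm, smul_smul, measureReal_def]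

theorem le_setAverage_sub_of_le_laplacian {v : E → ℝ} {x : E} {r c : ℝ} (hr : 0 < r)
    (hv : ∀ y ∈ closedBall x r, ContDiffAt ℝ 2 v y) (h : ∀ y ∈ ball x r, c ≤ Δ v y) :
    r ^ 2 / (2 * (finrank ℝ E + 2)) * c ≤ (⨍ y in ball x r, v y ∂μ) - v x := by
  have hmaps {y : E} (hy : y ∈ closedBall (0 : E) 1) : x + r • y ∈ closedBall x r := by
    simpa [dist_eq_norm, norm_smul, abs_of_pos hr, hr] using hy
  have hmaps' {y : E} (hy : y ∈ ball (0 : E) 1) : x + r • y ∈ ball x r := by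
    simpa [dist_eq_norm, norm_smul, abs_of_pos hr, hr] using hy
  obtain ⟨w, hw, hwc, heq⟩ :=
    exists_contDiff_hasCompactSupport_eqOn_closedBall (n := 2) (v := fun y => v (x + r • y))
      one_pos fun y hy => (hv _ (hmaps hy)).comp y (by fun_prop)
  have hlaplacian : ∀ y ∈ ball 0 1, r ^ 2 * c ≤ Δ w y := fun y hy => by
    have hnhds : w =ᶠ[𝓝 y] fun z => v (x + r • z) :=
      heq.eventuallyEq_of_mem (closedBall_mem_nhds_of_mem hy)
    rw [(laplacian_congr_nhds hnhds).eq_of_nhds,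
      laplacian_comp_add_smul (hv _ (hmaps (ball_subset_closedBall hy))), smul_eq_mul]
    exact mul_le_mul_of_nonneg_left (h _ (hmaps' hy)) (sq_nonneg r)
  have key := le_setAverage_unitBall_sub_of_le_laplacian μ hw hwc hlaplacian
  rw [heq (mem_closedBall_self zero_le_one), setAverage_congr_fun measurableSet_ball
    (.of_forall fun y hy => heq (ball_subset_closedBall hy)),
    ← setAverage_ball_eq_setAverage_unitBall μ v x hr] at key
  simpa [div_mul_eq_mul_div] using key

theorem setAverage_sub_le_of_laplacian_le {v : E → ℝ} {x : E} {r c : ℝ} (hr : 0 < r)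
    (hv : ∀ y ∈ closedBall x r, ContDiffAt ℝ 2 v y) (h : ∀ y ∈ ball x r, Δ v y ≤ c) :
    (⨍ y in ball x r, v y ∂μ) - v x ≤ r ^ 2 / (2 * (finrank ℝ E + 2)) * c := by
  have := le_setAverage_sub_of_le_laplacian μ (v := -v) (c := -c) hr (fun y hy => (hv y hy).neg)
    fun y hy => by simpa [laplacian_neg] using h y hy
  simp only [Pi.neg_apply, setAverage_eq, integral_neg, smul_neg] at this ⊢
  linarith

end MeanValueInequality

section PositiveOperator

variable {E : Type*} [NormedAddCommGroup E] [InnerProductSpace ℝ E]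

lemma norm_le_iff_isPositive_smul_one_sub {T : E →L[ℝ] E} (hT : T.IsPositive) {r : ℝ}
    (hr : 0 ≤ r) : ‖T‖ ≤ r ↔ (r • (1 : E →L[ℝ] E) - T).IsPositive := by
  have hinner (y : E) :
      inner ℝ ((r • (1 : E →L[ℝ] E) - T) y) y = r * ‖y‖ ^ 2 - inner ℝ (T y) y := by
    simp [inner_sub_left, real_inner_smul_left]
  constructor
  · refine fun h => ⟨?_, fun y => ?_⟩
    · exact (LinearMap.IsSymmetric.id.smul (by simp)).sub hT.isSymmetric
    · rw [ContinuousLinearMap.reApplyInnerSelf_apply, RCLike.re_to_real, hinner, sub_nonneg]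
      calc inner ℝ (T y) y ≤ ‖T y‖ * ‖y‖ := real_inner_le_norm _ _
        _ ≤ r * ‖y‖ * ‖y‖ := by gcongr; exact T.le_of_opNorm_le h y
        _ = r * ‖y‖ ^ 2 := by ring
  · intro h
    rw [T.norm_eq_iSup_rayleighQuotient hT.isSymmetric]
    refine ciSup_le fun y => ?_
    have hy : inner ℝ (T y) y ≤ r * ‖y‖ ^ 2 :=
      sub_nonneg.1 (hinner y ▸ h.inner_nonneg_left y)
    rw [ContinuousLinearMap.rayleighQuotient, abs_of_nonneg (div_nonneg (hT.2 y) (sq_nonneg _))]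
    exact div_le_of_le_mul₀ (sq_nonneg _) hr hy

end PositiveOperator

section BallMean

open Matrix (toEuclideanCLM)

variable {n : ℕ} {A : Matrix (Fin n) (Fin n) ℝ}

lemma norm_toEuclideanCLM_le_iff (hA : A.PosSemidef) {r : ℝ} (hr : 0 ≤ r) :
    ‖toEuclideanCLM (𝕜 := ℝ) A‖ ≤ r ↔ (r • (1 : Matrix (Fin n) (Fin n) ℝ) - A).PosSemidef := by
  have hpos (B : Matrix (Fin n) (Fin n) ℝ) :
      (toEuclideanCLM (𝕜 := ℝ) B).IsPositive ↔ B.PosSemidef := by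
    rw [← ContinuousLinearMap.isPositive_toLinearMap_iff,
      Matrix.coe_toEuclideanCLM_eq_toEuclideanLin, Matrix.isPositive_toEuclideanLin_iff]
  rw [norm_le_iff_isPositive_smul_one_sub ((hpos A).2 hA) hr, ← hpos, map_sub, map_smul, map_one]

variable {u : EuclideanSpace ℝ (Fin n) → ℝ} {x y : EuclideanSpace ℝ (Fin n)}

lemma laplacian_comp_toEuclideanCLM (hu : ContDiffAt ℝ 2 u (x + toEuclideanCLM (𝕜 := ℝ) A y)) :
    Δ (fun z => u (x + toEuclideanCLM (𝕜 := ℝ) A z)) y =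
      (Aᵀ * hessian u (x + toEuclideanCLM (𝕜 := ℝ) A y) * A).trace := by
  have hA (i : Fin n) : toEuclideanCLM (𝕜 := ℝ) A (EuclideanSpace.single i 1) =
      ∑ j, A j i • (EuclideanSpace.single j 1 : EuclideanSpace ℝ (Fin n)) := by
    ext k
    simp [Finset.sum_apply, Pi.single_apply]
  rw [laplacian_eq_sum_fderiv_fderiv (EuclideanSpace.basisFun (Fin n) ℝ)]
  simp only [EuclideanSpace.basisFun_apply, fderiv_fderiv_comp_add_clm hu, hA, map_sum, map_smul,
    sum_apply, smul_apply, smul_eq_mul, Matrix.trace, Matrix.diag_apply, Matrix.mul_apply,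
    Matrix.transpose_apply, hessian, Matrix.of_apply, Finset.mul_sum, Finset.sum_mul]
  exact Finset.sum_congr rfl fun i _ => Finset.sum_congr rfl fun j _ =>
    Finset.sum_congr rfl fun k _ => by ring

lemma continuousAt_hessian (hu : ContDiffAt ℝ 2 u x) : ContinuousAt (hessian u) x := by
  have h : ContinuousAt (fderiv ℝ (fderiv ℝ u)) x :=
    (hu.fderiv_right (m := 1) (by norm_num)).continuousAt_fderiv (by norm_num)
  refine tendsto_pi_nhds.2 fun i => tendsto_pi_nhds.2 fun j => ?_
  exact (h.clm_apply continuousAt_const).clm_apply continuousAt_const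

lemma le_ballMean_sub_of_le_trace {ε c : ℝ} (hε : 0 < ε)
    (hu : ∀ y ∈ closedBall 0 ε, ContDiffAt ℝ 2 u (x + toEuclideanCLM (𝕜 := ℝ) A y))
    (h : ∀ y ∈ ball 0 ε, c ≤ (Aᵀ * hessian u (x + toEuclideanCLM (𝕜 := ℝ) A y) * A).trace) :
    ε ^ 2 / (2 * (n + 2)) * c ≤ ballMean u x ε A - u x := by
  have key := le_setAverage_sub_of_le_laplacian volume
    (v := fun y => u (x + toEuclideanCLM (𝕜 := ℝ) A y)) hε
    (fun y hy => (hu y hy).comp y (by fun_prop))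
    fun y hy => (laplacian_comp_toEuclideanCLM (hu y (ball_subset_closedBall hy))).symm ▸ h y hy
  simpa [ballMean] using key

lemma ballMean_sub_le_of_trace_le {ε c : ℝ} (hε : 0 < ε)
    (hu : ∀ y ∈ closedBall 0 ε, ContDiffAt ℝ 2 u (x + toEuclideanCLM (𝕜 := ℝ) A y))
    (h : ∀ y ∈ ball 0 ε, (Aᵀ * hessian u (x + toEuclideanCLM (𝕜 := ℝ) A y) * A).trace ≤ c) :
    ballMean u x ε A - u x ≤ ε ^ 2 / (2 * (n + 2)) * c := by
  have key := setAverage_sub_le_of_laplacian_le volume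
    (v := fun y => u (x + toEuclideanCLM (𝕜 := ℝ) A y)) hε
    (fun y hy => (hu y hy).comp y (by fun_prop))
    fun y hy => (laplacian_comp_toEuclideanCLM (hu y (ball_subset_closedBall hy))).symm ▸ h y hy
  simpa [ballMean] using key

end BallMean

section Limit

lemma isLittleO_sInf_sub {α : Type*} {l : Filter α} {S : α → Set ℝ} {q : α → ℝ} {a f : ℝ}
    (hq : ∀ᶠ ε in l, 0 ≤ q ε)
    (hlower : ∀ c < f, ∀ᶠ ε in l, ∀ s ∈ S ε, q ε * c ≤ s - a)
    (hupper : ∀ c > f, ∀ᶠ ε in l, ∃ s ∈ S ε, s - a ≤ q ε * c) :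
    (fun ε => sInf (S ε) - a - q ε * f) =o[l] q := by
  refine isLittleO_iff.2 fun η hη => ?_
  filter_upwards [hq, hlower _ (sub_lt_self f hη), hupper _ (lt_add_of_pos_right f hη)]
    with ε hqε hl ⟨s, hs, hsu⟩
  have hbound : q ε * (f - η) + a ∈ lowerBounds (S ε) := fun t ht => by linarith [hl t ht]
  have hge : q ε * (f - η) + a ≤ sInf (S ε) := le_csInf ⟨s, hs⟩ hbound
  have hle : sInf (S ε) ≤ s := csInf_le ⟨_, hbound⟩ hs
  rw [Real.norm_of_nonneg hqε, Real.norm_eq_abs, abs_le]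
  constructor <;> linarith

open Matrix (toEuclideanCLM)

variable {n : ℕ} {𝒜 : Set (Matrix (Fin n) (Fin n) ℝ)} {u : EuclideanSpace ℝ (Fin n) → ℝ}
  {x : EuclideanSpace ℝ (Fin n)}

lemma coe_toReal_F (h𝒜 : 𝒜.Nonempty) {M : Matrix (Fin n) (Fin n) ℝ} (hM : M ∈ Gam 𝒜) :
    ((F 𝒜 M).toReal : EReal) = F 𝒜 M := by
  obtain ⟨A, hA⟩ := h𝒜
  exact EReal.coe_toReal ((iInf₂_le A hA).trans_lt (EReal.coe_lt_top _)).ne hM.2.ne'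

lemma eventually_forall_le_trace_hessian (hF : ContinuousOn (F 𝒜) (Gam 𝒜))
    (hu : ContDiffAt ℝ 2 u x) (hmem : ∀ᶠ z in 𝓝 x, hessian u z ∈ Gam 𝒜) {c : ℝ}
    (hc : c < F 𝒜 (hessian u x)) :
    ∀ᶠ z in 𝓝 x, ∀ A ∈ 𝒜, c ≤ (Aᵀ * hessian u z * A).trace := by
  have hlim : Tendsto (hessian u) (𝓝 x) (𝓝[Gam 𝒜] hessian u x) :=
    tendsto_nhdsWithin_iff.2 ⟨continuousAt_hessian hu, hmem⟩
  filter_upwards [((hF _ hmem.self_of_nhds).tendsto.comp hlim).eventually_const_lt hc]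
    with z hz A hA
  exact EReal.coe_le_coe_iff.1 (hz.le.trans (iInf₂_le A hA))

lemma exists_trace_lt {M : Matrix (Fin n) (Fin n) ℝ} {c : ℝ} (h : F 𝒜 M < c) :
    ∃ A ∈ 𝒜, (Aᵀ * M * A).trace < c := by
  simpa [F, iInf_lt_iff] using h

lemma eventually_trace_hessian_le {A : Matrix (Fin n) (Fin n) ℝ} (hu : ContDiffAt ℝ 2 u x) {c : ℝ}
    (hc : (Aᵀ * hessian u x * A).trace < c) :
    ∀ᶠ z in 𝓝 x, (Aᵀ * hessian u z * A).trace ≤ c := by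
  have hcont : Continuous fun M : Matrix (Fin n) (Fin n) ℝ => (Aᵀ * M * A).trace := by fun_prop
  exact ((hcont.continuousAt.comp (continuousAt_hessian hu)).eventually_lt_const hc).mono
    fun z hz => hz.le

lemma eventually_mem_truncation {A : Matrix (Fin n) (Fin n) ℝ} (hA : A ∈ 𝒜) (hpsd : A.PosSemidef) :
    ∀ᶠ r in atTop, A ∈ truncation 𝒜 r := by
  filter_upwards [eventually_ge_atTop ‖toEuclideanCLM (𝕜 := ℝ) A‖] with r hr
  exact ⟨hA, (norm_toEuclideanCLM_le_iff hpsd ((norm_nonneg _).trans hr)).1 hr⟩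

variable {φ : ℝ → ℝ}

lemma eventually_forall_truncation_mapsTo (hpsd : ∀ A ∈ 𝒜, A.PosSemidef)
    (hφ : Tendsto φ (𝓝[>] 0) atTop) (hεφ : Tendsto (fun ε => ε * φ ε) (𝓝[>] 0) (𝓝 0))
    {s : Set (EuclideanSpace ℝ (Fin n))} (hs : s ∈ 𝓝 x) :
    ∀ᶠ ε in 𝓝[>] 0, ∀ A ∈ truncation 𝒜 (φ ε),
      MapsTo (fun y => x + toEuclideanCLM (𝕜 := ℝ) A y) (closedBall 0 ε) s := by
  obtain ⟨δ, hδ, hsub⟩ := Metric.mem_nhds_iff.1 hs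
  filter_upwards [hφ.eventually_ge_atTop 0, hεφ.eventually_lt_const hδ] with ε hr hlt A hA y hy
  refine hsub (mem_ball_iff_norm.2 ?_)
  have hnorm : ‖toEuclideanCLM (𝕜 := ℝ) A‖ ≤ φ ε :=
    (norm_toEuclideanCLM_le_iff (hpsd A hA.1) hr).2 hA.2
  calc ‖x + toEuclideanCLM (𝕜 := ℝ) A y - x‖ = ‖toEuclideanCLM (𝕜 := ℝ) A y‖ := by
        rw [add_sub_cancel_left]
    _ ≤ φ ε * ε := ContinuousLinearMap.le_of_opNorm_le_of_le _ hnorm (mem_closedBall_zero_iff.1 hy)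
    _ < δ := by rwa [mul_comm]

lemma eventually_forall_le_ballMean_sub (hpsd : ∀ A ∈ 𝒜, A.PosSemidef)
    (hφ : Tendsto φ (𝓝[>] 0) atTop) (hεφ : Tendsto (fun ε => ε * φ ε) (𝓝[>] 0) (𝓝 0))
    (hF : ContinuousOn (F 𝒜) (Gam 𝒜)) (hu : ContDiffAt ℝ 2 u x)
    (hmem : ∀ᶠ z in 𝓝 x, hessian u z ∈ Gam 𝒜) {c : ℝ} (hc : c < F 𝒜 (hessian u x)) :
    ∀ᶠ ε in 𝓝[>] 0, ∀ A ∈ truncation 𝒜 (φ ε),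
      ε ^ 2 / (2 * (n + 2)) * c ≤ ballMean u x ε A - u x := by
  have hnear := (hu.eventually (by norm_num)).and (eventually_forall_le_trace_hessian hF hu hmem hc)
  filter_upwards [eventually_mem_nhdsWithin,
    eventually_forall_truncation_mapsTo hpsd hφ hεφ hnear] with ε hε hmaps A hA
  exact le_ballMean_sub_of_le_trace hε (fun y hy => (hmaps A hA hy).1)
    fun y hy => (hmaps A hA (ball_subset_closedBall hy)).2 A hA.1

lemma eventually_exists_ballMean_sub_le (hpsd : ∀ A ∈ 𝒜, A.PosSemidef)
    (hφ : Tendsto φ (𝓝[>] 0) atTop) (hεφ : Tendsto (fun ε => ε * φ ε) (𝓝[>] 0) (𝓝 0))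
    (hu : ContDiffAt ℝ 2 u x) {c : ℝ} (hc : F 𝒜 (hessian u x) < c) :
    ∀ᶠ ε in 𝓝[>] 0, ∃ A ∈ truncation 𝒜 (φ ε),
      ballMean u x ε A - u x ≤ ε ^ 2 / (2 * (n + 2)) * c := by
  obtain ⟨A, hA, htrace⟩ := exists_trace_lt hc
  have hnear := (hu.eventually (by norm_num)).and (eventually_trace_hessian_le hu htrace)
  filter_upwards [eventually_mem_nhdsWithin,
    eventually_forall_truncation_mapsTo hpsd hφ hεφ hnear,
    hφ.eventually (eventually_mem_truncation hA (hpsd A hA))] with ε hε hmaps hAε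
  exact ⟨A, hAε, ballMean_sub_le_of_trace_le hε (fun y hy => (hmaps A hAε hy).1)
    fun y hy => (hmaps A hAε (ball_subset_closedBall hy)).2⟩

lemma integrableOn_comp_add_toEuclideanCLM {A : Matrix (Fin n) (Fin n) ℝ}
    {Ω : Set (EuclideanSpace ℝ (Fin n))} {ε : ℝ} (hu : ContinuousOn u Ω)
    (hmaps : MapsTo (fun y => x + toEuclideanCLM (𝕜 := ℝ) A y) (closedBall 0 ε) Ω) :
    IntegrableOn (fun y => u (x + toEuclideanCLM (𝕜 := ℝ) A y)) (ball 0 ε) :=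
  ((hu.comp (by fun_prop) hmaps).integrableOn_compact (isCompact_closedBall 0 ε)).mono_set
    ball_subset_closedBall

end Limit

end MeanValue

theorem theorem1p5 (n : ℕ) (hn : 1 ≤ n)
    (𝒜 : Set (Matrix (Fin n) (Fin n) ℝ)) (h𝒜 : 𝒜.Nonempty)
    (hpsd : ∀ A ∈ 𝒜, A.PosSemidef)
    (hF : ContinuousOn (MeanValue.F 𝒜) (MeanValue.Gam 𝒜))
    (Ω : Set (EuclideanSpace ℝ (Fin n))) (hΩ : IsOpen Ω)
    (u : EuclideanSpace ℝ (Fin n) → ℝ) (hu : MeanValue.IsAdmissible 𝒜 Ω u)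
    (φ : ℝ → ℝ) (hφpos : ∀ ε : ℝ, 0 < ε → 0 < φ ε)
    (hφ : Tendsto φ (𝓝[>] 0) atTop)
    (hεφ : Tendsto (fun ε => ε * φ ε) (𝓝[>] 0) (𝓝 0))
    (x : EuclideanSpace ℝ (Fin n)) (hx : x ∈ Ω) :
    -- for small `ε` the infimum is a genuine one: the set of matrices is nonempty, the averages
    -- only involve values of `u` in `Ω`, the integrals exist and are bounded below
    (∀ᶠ ε in 𝓝[>] (0 : ℝ),
      (MeanValue.truncation 𝒜 (φ ε)).Nonempty ∧
      (∀ A ∈ MeanValue.truncation 𝒜 (φ ε),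
        (∀ y ∈ Metric.ball (0 : EuclideanSpace ℝ (Fin n)) ε,
          x + Matrix.toEuclideanCLM (n := Fin n) (𝕜 := ℝ) A y ∈ Ω) ∧
        IntegrableOn (fun y => u (x + Matrix.toEuclideanCLM (n := Fin n) (𝕜 := ℝ) A y))
          (Metric.ball 0 ε)) ∧
      BddBelow (MeanValue.ballMean u x ε '' MeanValue.truncation 𝒜 (φ ε))) ∧
    (fun ε : ℝ =>
      sInf (MeanValue.ballMean u x ε '' MeanValue.truncation 𝒜 (φ ε)) - u x
        - ε ^ 2 / (2 * ((n : ℝ) + 2)) * (MeanValue.F 𝒜 (MeanValue.hessian u x)).toReal)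
      =o[𝓝[>] 0] (fun ε : ℝ => ε ^ 2) := by
  set f := (MeanValue.F 𝒜 (MeanValue.hessian u x)).toReal
  have hcoe : (f : EReal) = _ := MeanValue.coe_toReal_F h𝒜 (hu.2 x hx)
  have hu2 : ContDiffAt ℝ 2 u x := hu.1.contDiffAt (hΩ.mem_nhds hx)
  have hmem : ∀ᶠ z in 𝓝 x, MeanValue.hessian u z ∈ MeanValue.Gam 𝒜 :=
    eventually_of_mem (hΩ.mem_nhds hx) hu.2
  have hlower (c : ℝ) (hc : c < f) := MeanValue.eventually_forall_le_ballMean_sub hpsd hφ hεφ hF hu2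
    hmem (hcoe ▸ EReal.coe_lt_coe_iff.2 hc)
  have hupper (c : ℝ) (hc : f < c) := MeanValue.eventually_exists_ballMean_sub_le hpsd hφ hεφ hu2
    (hcoe ▸ EReal.coe_lt_coe_iff.2 hc)
  constructor
  · filter_upwards [MeanValue.eventually_forall_truncation_mapsTo hpsd hφ hεφ (hΩ.mem_nhds hx),
      hlower _ (sub_one_lt f), hupper _ (lt_add_one f)] with ε hmaps hbdd ⟨A₀, hA₀, _⟩
    refine ⟨⟨A₀, hA₀⟩, fun A hA => ⟨fun y hy => hmaps A hA (Metric.ball_subset_closedBall hy), ?_⟩,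
      ⟨_, Set.forall_mem_image.2 fun A hA => le_sub_iff_add_le.1 (hbdd A hA)⟩⟩
    exact MeanValue.integrableOn_comp_add_toEuclideanCLM hu.1.continuousOn (hmaps A hA)
  · refine (MeanValue.isLittleO_sInf_sub (.of_forall fun ε => by positivity)
      (fun c hc => ?_) fun c hc => ?_).trans_isBigO ?_
    · simpa using hlower c hc
    · simpa using hupper c hc
    · simpa only [div_eq_inv_mul] using isBigO_const_mul_self _ (fun ε : ℝ => ε ^ 2) _
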